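/- Let $\Omega\subset\mathbb R^n$ be a bounded, open, connected set with Lipschitz boundary, let $\mathcal M\subset\partial\Omega$ be a measurable part of the boundary, and let $\mu$ denote the $(n-1)$-dimensional surface measure on $\partial\Omega$. Let $\psi\in L^2(\mathcal M)$ and let $\varphi$ be a real function on $\partial\Omega$. Write $\|\cdot\|_\Omega$ and $\|\cdot\|_{\mathcal M}$ for the norms of $L^2(\Omega)$ (of scalar or vector functions) and $L^2(\mathcal M)$; boundary values of $H^1(\Omega)$-functions are understood in the sense of traces. Put $$\mathbb K_{\mathcal S}=\{v\in H^1(\Omega): v\ge\psi \text{ a.e. on }\mathcal M,\ v=\varphi\text{ a.e. on }\partial\Omega\setminus\mathcal M\},$$ $$H^1_{0,\mathcal S}(\Omega)=\{w\in H^1(\Omega): w=0\text{ a.e. on }\partial\Omega\setminus\mathcal M\},\qquad \Lambda=\{\lambda\in L^2(\mathcal M):\lambda\ge 0\text{ a.e. on }\mathcal M\},$$ and let $H^{\mathcal S}(\Omega,\mathrm{div})$ be the set of all $q^*\in L^2(\Omega,\mathbb R^n)$ with weak divergence $\mathrm{div}\,q^*\in L^2(\Omega)$ and with outer normal component $q^*\cdot\mathbf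 n\in L^2(\mathcal M)$, the latter meaning that $$\int_\Omega q^*\cdot\nabla w\,dx+\int_\Omega w\,\mathrm{div}\,q^*\,dx=\int_{\mathcal M}(q^*\cdot\mathbf n)\,w\,d\mu\qquad\text{for all } w\in H^1_{0,\mathcal S}(\Omega).$$ Let $u\in\mathbb K_{\mathcal S}$ minimize $J(v)=\frac12\int_\Omega|\nabla v|^2dx$ over $\mathbb K_{\mathcal S}$ (the scalar Signorini, or boundary thin obstacle, problem). Let $v\in\mathbb K_{\mathcal S}$, $\lambda\in\Lambda$ and $q^*\in H^{\mathcal S}(\Omega,\mathrm{div})$ be arbitrary. (a) Let $C_{F_\Omega}\ge 0$ and $C_{Tr_{\mathcal M}}\ge 0$ be constants in the Friedrichs and trace inequalities, that is, $\|w\|_\Omega\le C_{F_\Omega}\|\nabla w\|_\Omega$ and $\|w\|_{\mathcal M}\le C_{Tr_{\mathcal M}}\|\nabla w\|_\Omega$ for all $w\in H^1_{0,\mathcal S}(\Omega)$. Then $$\|\nabla(v-u)\|_\Omega\le\|\nabla v-q^*\|_\Omega+\sqrt2\Big(\int_{\mathcal M}\lambda(v-\psi)\,d\mu\Big)^{1/2}+C_{F_\Omega}\|\mathrm{div}\,q^*\|_\Omega+C_{Tr_{\mathcal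 M}}\|\lambda-q^*\cdot\mathbf n\|_{\mathcal M}.$$ (b) Suppose in addition that $\int_\Omega\mathrm{div}\,q^*\,dx=0$ and $\int_{\mathcal M}(\lambda-q^*\cdot\mathbf n)\,d\mu=0$. Let $C_{P_\Omega}\ge 0$ and $C_{P_{\mathcal M}}\ge 0$ be constants in the Poincaré type inequalities $\|w\|_\Omega\le C_{P_\Omega}\|\nabla w\|_\Omega$ for all $w\in H^1(\Omega)$ with $\int_\Omega w\,dx=0$, and $\|w\|_{\mathcal M}\le C_{P_{\mathcal M}}\|\nabla w\|_\Omega$ for all $w\in H^1(\Omega)$ with $\int_{\mathcal M}w\,d\mu=0$. Then $$\|\nabla(v-u)\|_\Omega\le\|\nabla v-q^*\|_\Omega+\sqrt2\Big(\int_{\mathcal M}\lambda(v-\psi)\,d\mu\Big)^{1/2}+C_{P_\Omega}\|\mathrm{div}\,q^*\|_\Omega+C_{P_{\mathcal M}}\|\lambda-q^*\cdot\mathbf n\|_{\mathcal M}.$$ -/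

import Mathlib

open MeasureTheory Set Filter Topology
open scoped ContDiff ENNReal

namespace Signorini

/-- `n`-dimensional Euclidean space. -/
abbrev Euc (n : ℕ) : Type := EuclideanSpace ℝ (Fin n)

/-- `Ω` has Lipschitz boundary: near every boundary point, after a rotation (the direction `ν` is
the vertical one), `Ω` is the strict supergraph of a Lipschitz function of the component
`y - ⟪ν, y⟫ ν` of `y` orthogonal to `ν`. -/
def HasLipschitzBoundary {n : ℕ} (Ω : Set (Euc n)) : Prop :=
  ∀ x ∈ frontier Ω, ∃ (r : ℝ) (ν : Euc n) (K : NNReal) (g : Euc n → ℝ),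
    0 < r ∧ ‖ν‖ = 1 ∧ LipschitzWith K g ∧
      ∀ y ∈ Metric.ball x r, y ∈ Ω ↔ g (y - inner ℝ ν y • ν) < inner ℝ ν y

/-- Bounded Lipschitz domain: open, connected (and nonempty), bounded, with Lipschitz boundary. -/
structure IsLipschitzDomain {n : ℕ} (Ω : Set (Euc n)) : Prop where
  isOpen : IsOpen Ω
  isConnected : IsConnected Ω
  isBounded : Bornology.IsBounded Ω
  lipschitz : HasLipschitzBoundary Ω

/-- Lebesgue measure on `Ω`. -/
noncomputable def vol {n : ℕ} (Ω : Set (Euc n)) : Measure (Euc n) :=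
  (volume : Measure (Euc n)).restrict Ω

/-- Surface measure, i.e. the `(n-1)`-dimensional Hausdorff measure (normalized so as to agree with
the `(n-1)`-dimensional Lebesgue measure on hyperplanes), on a subset `S` of `ℝⁿ`. -/
noncomputable def surf {n : ℕ} (S : Set (Euc n)) : Measure (Euc n) :=
  (Measure.euclideanHausdorffMeasure (n - 1) : Measure (Euc n)).restrict S

/-- `G` is the weak (distributional) gradient of `w` in `Ω`. -/
def IsWeakGrad {n : ℕ} (Ω : Set (Euc n)) (w : Euc n → ℝ) (G : Euc n → Euc n) : Prop :=
  ∀ η : Euc n → ℝ, ContDiff ℝ ∞ η → HasCompactSupport η → tsupport η ⊆ Ω →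
    ∫ x, w x • gradient η x ∂(vol Ω) = -∫ x, η x • G x ∂(vol Ω)

/-- `d` is the weak (distributional) divergence of the vector field `q` in `Ω`. -/
def IsWeakDiv {n : ℕ} (Ω : Set (Euc n)) (q : Euc n → Euc n) (d : Euc n → ℝ) : Prop :=
  ∀ η : Euc n → ℝ, ContDiff ℝ ∞ η → HasCompactSupport η → tsupport η ⊆ Ω →
    ∫ x, inner ℝ (q x) (gradient η x) ∂(vol Ω) = -∫ x, d x * η x ∂(vol Ω)

/-- An element of the Sobolev space `H¹(Ω)` (a representative of it), together with (a
representative of) its weak gradient, which is determined almost everywhere in `Ω`. -/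
structure H1 {n : ℕ} (Ω : Set (Euc n)) where
  toFun : Euc n → ℝ
  grad : Euc n → Euc n
  memLp_toFun : MemLp toFun 2 (vol Ω)
  memLp_grad : MemLp grad 2 (vol Ω)
  isWeakGrad : IsWeakGrad Ω toFun grad

/-- `g` is the boundary trace of `w ∈ H¹(Ω)`: the trace operator is the extension by continuity,
as an operator from `H¹(Ω)` to `L²(∂Ω)`, of the restriction of smooth functions to `∂Ω`. Hence `g`
is the trace of `w` when there are smooth functions `W k` that converge to `w` in `H¹(Ω)` and
whose restrictions to `∂Ω` converge to `g` in `L²(∂Ω)`. -/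
def HasTrace {n : ℕ} {Ω : Set (Euc n)} (w : H1 Ω) (g : Euc n → ℝ) : Prop :=
  MemLp g 2 (surf (frontier Ω)) ∧
    ∃ W : ℕ → Euc n → ℝ, (∀ k, ContDiff ℝ ∞ (W k)) ∧
      Tendsto (fun k => eLpNorm (fun x => W k x - w.toFun x) 2 (vol Ω)) atTop (𝓝 0) ∧
      Tendsto (fun k => eLpNorm (fun x => gradient (W k) x - w.grad x) 2 (vol Ω)) atTop (𝓝 0) ∧
      Tendsto (fun k => eLpNorm (fun x => W k x - g x) 2 (surf (frontier Ω))) atTop (𝓝 0)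

/-- `v ∈ H¹(Ω)` has trace `g` on `∂Ω`, with `g ≥ ψ` on `M` and `g = φ` on `∂Ω \ M`. -/
def IsAdmissible {n : ℕ} {Ω : Set (Euc n)} (M : Set (Euc n)) (ψ φ : Euc n → ℝ)
    (v : H1 Ω) (g : Euc n → ℝ) : Prop :=
  HasTrace v g ∧ (∀ᵐ x ∂(surf M), ψ x ≤ g x) ∧ (∀ᵐ x ∂(surf (frontier Ω \ M)), g x = φ x)

/-- The convex set of the Signorini problem: all `v ∈ H¹(Ω)` such that, in the sense of traces,
`v ≥ ψ` on `M` and `v = φ` on `∂Ω \ M`. -/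
def KS {n : ℕ} (Ω M : Set (Euc n)) (ψ φ : Euc n → ℝ) : Set (H1 Ω) :=
  {v | ∃ g, IsAdmissible M ψ φ v g}

/-- The energy `J(v) = ½ ∫_Ω |∇v|² dx`. -/
noncomputable def energy {n : ℕ} {Ω : Set (Euc n)} (v : H1 Ω) : ℝ :=
  (1 / 2) * ∫ x, ‖v.grad x‖ ^ 2 ∂(vol Ω)

/-- `w` belongs to `H¹_{0,S}(Ω)` (its trace vanishes on `∂Ω \ M`), and its trace is `g`. -/
def HasTraceH10S {n : ℕ} {Ω : Set (Euc n)} (M : Set (Euc n)) (w : H1 Ω) (g : Euc n → ℝ) : Prop :=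
  HasTrace w g ∧ ∀ᵐ x ∂(surf (frontier Ω \ M)), g x = 0

/-- The set `Λ` of multipliers: `λ ∈ L²(M)` with `λ ≥ 0` almost everywhere on `M`. -/
def MemMultipliers {n : ℕ} (M : Set (Euc n)) (lam : Euc n → ℝ) : Prop :=
  MemLp lam 2 (surf M) ∧ ∀ᵐ x ∂(surf M), 0 ≤ lam x

/-- `qn` is the (outer) normal component `q · n` of `q` on `M`, where `d = div q`. It is defined
by Green's formula, tested with the functions of `H¹` whose trace vanishes on `∂Ω \ M`. -/
def IsNormalTrace {n : ℕ} (Ω M : Set (Euc n)) (q : Euc n → Euc n) (d qn : Euc n → ℝ) : Prop :=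
  ∀ (w : H1 Ω) (g : Euc n → ℝ), HasTraceH10S M w g →
    ∫ x, inner ℝ (q x) (w.grad x) ∂(vol Ω) + ∫ x, d x * w.toFun x ∂(vol Ω)
      = ∫ x, qn x * g x ∂(surf M)

/-- `q ∈ H^S(Ω, div)`: `q ∈ L²(Ω, ℝⁿ)` with `div q = d ∈ L²(Ω)` and `q · n = qn ∈ L²(M)`. -/
structure MemHSDiv {n : ℕ} (Ω M : Set (Euc n)) (q : Euc n → Euc n) (d qn : Euc n → ℝ) :
    Prop where
  memLp : MemLp q 2 (vol Ω)
  memLp_div : MemLp d 2 (vol Ω)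
  memLp_normal : MemLp qn 2 (surf M)
  isWeakDiv : IsWeakDiv Ω q d
  isNormalTrace : IsNormalTrace Ω M q d qn

/-- `C` is a constant in the Friedrichs inequality `‖w‖_Ω ≤ C ‖∇w‖_Ω` for `w ∈ H¹_{0,S}(Ω)`. -/
def IsFriedrichsConst {n : ℕ} (Ω M : Set (Euc n)) (C : ℝ) : Prop :=
  0 ≤ C ∧ ∀ (w : H1 Ω) (g : Euc n → ℝ), HasTraceH10S M w g →
    lpNorm w.toFun 2 (vol Ω) ≤ C * lpNorm w.grad 2 (vol Ω)

/-- `C` is a constant in the trace inequality `‖w‖_M ≤ C ‖∇w‖_Ω` for `w ∈ H¹_{0,S}(Ω)`. -/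
def IsTraceConst {n : ℕ} (Ω M : Set (Euc n)) (C : ℝ) : Prop :=
  0 ≤ C ∧ ∀ (w : H1 Ω) (g : Euc n → ℝ), HasTraceH10S M w g →
    lpNorm g 2 (surf M) ≤ C * lpNorm w.grad 2 (vol Ω)

/-- `C` is a constant in the Poincaré inequality `‖w‖_Ω ≤ C ‖∇w‖_Ω` for `w ∈ H¹(Ω)` with zero
mean over `Ω`. -/
def IsPoincareConst {n : ℕ} (Ω : Set (Euc n)) (C : ℝ) : Prop :=
  0 ≤ C ∧ ∀ w : H1 Ω, ∫ x, w.toFun x ∂(vol Ω) = 0 →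
    lpNorm w.toFun 2 (vol Ω) ≤ C * lpNorm w.grad 2 (vol Ω)

/-- `C` is a constant in the Poincaré type inequality `‖w‖_M ≤ C ‖∇w‖_Ω` for `w ∈ H¹(Ω)` whose
trace has zero mean over `M`. -/
def IsBoundaryPoincareConst {n : ℕ} (Ω M : Set (Euc n)) (C : ℝ) : Prop :=
  0 ≤ C ∧ ∀ (w : H1 Ω) (g : Euc n → ℝ), HasTrace w g → ∫ x, g x ∂(surf M) = 0 →
    lpNorm g 2 (surf M) ≤ C * lpNorm w.grad 2 (vol Ω)

end Signorini

/-! Put e = v - u. Moving from u towards v inside the convex set gives the variational inequality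
∫∇u·∇e ≥ 0, so ‖∇e‖² ≤ ∫(∇v - q)·∇e + ∫q·∇e. Both traces equal φ off M, so e may be tested in
Green's formula, and ∫q·∇e = ∫_M λe - ∫_M (λ - q·n)e - ∫_Ω e div q. Since λ ≥ 0 and u ≥ ψ, the first
term is at most B = ∫_M λ(v - ψ).

If the two residual terms are bounded by CF‖div q‖‖∇e‖ and CT‖λ - q·n‖‖∇e‖, then X = ‖∇e‖ satisfies
X² ≤ A X + B, whence X ≤ A + √B. This is `lpNorm_grad_sub_le`. In (a) the bounds are the Friedrichs
and trace inequalities for e. In (b) the residuals have zero mean, so e may be replaced by e minus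
its mean, over Ω or over M, without changing ∇e. This needs constants to be H¹ functions with L²
traces, hence finite surface measure of ∂Ω (`isFiniteMeasure_surf`). -/

namespace Signorini

/-! ### Cauchy–Schwarz in L². -/

section L2

variable {α : Type*} [MeasurableSpace α] {μ : Measure α}
  {E : Type*} [NormedAddCommGroup E] [InnerProductSpace ℝ E]

theorem integrable_inner_of_memLp {f g : α → E} (hf : MemLp f 2 μ) (hg : MemLp g 2 μ) :
    Integrable (fun x => inner ℝ (f x) (g x)) μ := by
  refine (L2.integrable_inner (𝕜 := ℝ) (hf.toLp f) (hg.toLp g)).congr ?_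
  filter_upwards [hf.coeFn_toLp, hg.coeFn_toLp] with x h1 h2
  rw [h1, h2]

theorem integral_inner_eq_inner_toLp {f g : α → E} (hf : MemLp f 2 μ) (hg : MemLp g 2 μ) :
    ∫ x, inner ℝ (f x) (g x) ∂μ = inner ℝ (hf.toLp f) (hg.toLp g) := by
  rw [L2.inner_def]
  refine integral_congr_ae ?_
  filter_upwards [hf.coeFn_toLp, hg.coeFn_toLp] with x h1 h2
  rw [h1, h2]

theorem integrable_mul_of_memLp {f g : α → ℝ} (hf : MemLp f 2 μ) (hg : MemLp g 2 μ) :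
    Integrable (fun x => f x * g x) μ :=
  hf.integrable_mul hg

theorem integrable_smul_of_memLp {f : α → ℝ} {g : α → E} (hf : MemLp f 2 μ) (hg : MemLp g 2 μ) :
    Integrable (fun x => f x • g x) μ :=
  memLp_one_iff_integrable.1 (hg.smul hf)

theorem norm_toLp_eq_lpNorm {F : Type*} [NormedAddCommGroup F] {f : α → F} (hf : MemLp f 2 μ) : ‖hf.toLp f‖ = lpNorm f 2 μ := by
  rw [Lp.norm_toLp, toReal_eLpNorm hf.1]

theorem integral_inner_le_lpNorm_mul_lpNorm {f g : α → E} (hf : MemLp f 2 μ) (hg : MemLp g 2 μ) :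
    ∫ x, inner ℝ (f x) (g x) ∂μ ≤ lpNorm f 2 μ * lpNorm g 2 μ := by
  rw [integral_inner_eq_inner_toLp hf hg, ← norm_toLp_eq_lpNorm hf, ← norm_toLp_eq_lpNorm hg]
  exact real_inner_le_norm _ _

theorem abs_integral_mul_le_lpNorm_mul_lpNorm {f g : α → ℝ} (hf : MemLp f 2 μ)
    (hg : MemLp g 2 μ) : |∫ x, f x * g x ∂μ| ≤ lpNorm f 2 μ * lpNorm g 2 μ := by
  have h : ∫ x, f x * g x ∂μ = ∫ x, inner ℝ (f x) (g x) ∂μ := by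
    simp [mul_comm]
  rw [h, integral_inner_eq_inner_toLp hf hg, ← norm_toLp_eq_lpNorm hf, ← norm_toLp_eq_lpNorm hg]
  exact abs_real_inner_le_norm _ _

theorem lpNorm_sq_eq_integral_inner {f : α → E} (hf : MemLp f 2 μ) :
    lpNorm f 2 μ ^ 2 = ∫ x, inner ℝ (f x) (f x) ∂μ := by
  rw [integral_inner_eq_inner_toLp hf hf, real_inner_self_eq_norm_sq, norm_toLp_eq_lpNorm hf]

/-- If `d` has zero mean, a constant may be subtracted from `w` in `∫ d w`. -/
theorem abs_integral_mul_le_of_integral_eq_zero [IsFiniteMeasure μ] {d w : α → ℝ} {A : ℝ}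
    (hd : MemLp d 2 μ) (hw : MemLp w 2 μ) (h0 : ∫ x, d x ∂μ = 0) (c : ℝ)
    (hA : lpNorm (fun x => w x - c) 2 μ ≤ A) :
    |∫ x, d x * w x ∂μ| ≤ A * lpNorm d 2 μ := by
  have hwc : MemLp (fun x => w x - c) 2 μ := hw.sub (memLp_const c)
  have h1 : ∫ x, d x * w x ∂μ = ∫ x, d x * (w x - c) ∂μ := by
    simp_rw [mul_sub]
    rw [integral_sub (integrable_mul_of_memLp hd hw) ((hd.integrable one_le_two).mul_const c),
      integral_mul_const, h0]
    simp
  rw [h1]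
  refine (abs_integral_mul_le_lpNorm_mul_lpNorm hd hwc).trans ?_
  rw [mul_comm]
  gcongr
  exact lpNorm_nonneg

end L2

/-! ### Linear combinations in H¹ and of traces. -/

variable {n : ℕ} {Ω M : Set (Euc n)}

theorem tendsto_eLpNorm_linearCombination {α E : Type*} [MeasurableSpace α] {μ : Measure α}
    [NormedAddCommGroup E] [NormedSpace ℝ E] (a b : ℝ) {f g h : ℕ → α → E}
    (hf : Tendsto (fun k => eLpNorm (f k) 2 μ) atTop (𝓝 0))
    (hg : Tendsto (fun k => eLpNorm (g k) 2 μ) atTop (𝓝 0))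
    (hfm : ∀ k, AEStronglyMeasurable (f k) μ) (hgm : ∀ k, AEStronglyMeasurable (g k) μ)
    (hh : ∀ k x, h k x = a • f k x + b • g k x) :
    Tendsto (fun k => eLpNorm (h k) 2 μ) atTop (𝓝 0) := by
  have key : Tendsto (fun k => ‖a‖ₑ * eLpNorm (f k) 2 μ + ‖b‖ₑ * eLpNorm (g k) 2 μ)
      atTop (𝓝 0) := by
    simpa using (ENNReal.Tendsto.const_mul hf (Or.inr (by simp))).add
      (ENNReal.Tendsto.const_mul hg (Or.inr (by simp)))
  refine tendsto_of_tendsto_of_tendsto_of_le_of_le tendsto_const_nhds key (fun _ => zero_le)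
    (fun k => ?_)
  have : h k = a • f k + b • g k := funext (hh k)
  rw [this]
  refine (eLpNorm_add_le ((hfm k).const_smul a) ((hgm k).const_smul b) one_le_two).trans ?_
  rw [eLpNorm_const_smul, eLpNorm_const_smul]

theorem gradient_linearCombination {f g : Euc n → ℝ} (a b : ℝ) (hf : Differentiable ℝ f)
    (hg : Differentiable ℝ g) (x : Euc n) :
    gradient (fun y => a * f y + b * g y) x = a • gradient f x + b • gradient g x := by
  have h := ((hf x).hasFDerivAt.const_mul a).add ((hg x).hasFDerivAt.const_mul b)
  have h' : fderiv ℝ (fun y => a * f y + b * g y) x = a • fderiv ℝ f x + b • fderiv ℝ g x :=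
    h.fderiv
  simp [gradient, h']

theorem continuous_gradient {f : Euc n → ℝ} (hf : ContDiff ℝ ∞ f) : Continuous (gradient f) :=
  (InnerProductSpace.toDual ℝ (Euc n)).symm.continuous.comp (hf.continuous_fderiv (by simp))

theorem hasCompactSupport_gradient {f : Euc n → ℝ} (hf : HasCompactSupport f) :
    HasCompactSupport (gradient f) :=
  (hf.fderiv ℝ).comp_left (g := (InnerProductSpace.toDual ℝ (Euc n)).symm) (map_zero _)

theorem IsWeakGrad.linearCombination {w₁ w₂ : Euc n → ℝ} {G₁ G₂ : Euc n → Euc n} (a b : ℝ)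
    (hw₁ : MemLp w₁ 2 (vol Ω)) (hw₂ : MemLp w₂ 2 (vol Ω)) (hG₁ : MemLp G₁ 2 (vol Ω))
    (hG₂ : MemLp G₂ 2 (vol Ω)) (h₁ : IsWeakGrad Ω w₁ G₁) (h₂ : IsWeakGrad Ω w₂ G₂) :
    IsWeakGrad Ω (fun x => a * w₁ x + b * w₂ x) (fun x => a • G₁ x + b • G₂ x) := by
  intro η hη hc hs
  have hηL : MemLp η 2 (vol Ω) := (hη.continuous.memLp_of_hasCompactSupport hc).restrict Ω
  have hgL : MemLp (gradient η) 2 (vol Ω) :=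
    ((continuous_gradient hη).memLp_of_hasCompactSupport (hasCompactSupport_gradient hc)).restrict Ω
  have i₁ : Integrable (fun x => w₁ x • gradient η x) (vol Ω) := integrable_smul_of_memLp hw₁ hgL
  have i₂ : Integrable (fun x => w₂ x • gradient η x) (vol Ω) := integrable_smul_of_memLp hw₂ hgL
  have j₁ : Integrable (fun x => η x • G₁ x) (vol Ω) := integrable_smul_of_memLp hηL hG₁
  have j₂ : Integrable (fun x => η x • G₂ x) (vol Ω) := integrable_smul_of_memLp hηL hG₂
  have e₁ : ∀ x, (a * w₁ x + b * w₂ x) • gradient η x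
      = a • (w₁ x • gradient η x) + b • (w₂ x • gradient η x) := fun x => by module
  have e₂ : ∀ x, η x • (a • G₁ x + b • G₂ x) = a • (η x • G₁ x) + b • (η x • G₂ x) :=
    fun x => by module
  simp_rw [e₁, e₂]
  rw [integral_add (i₁.fun_smul a) (i₂.fun_smul b), integral_add (j₁.fun_smul a) (j₂.fun_smul b),
    integral_smul, integral_smul, integral_smul, integral_smul, h₁ η hη hc hs, h₂ η hη hc hs]
  module

/-- The linear combination `a w₁ + b w₂` of two elements of `H¹(Ω)`. -/
def H1.linearCombination (a b : ℝ) (w₁ w₂ : H1 Ω) : H1 Ω where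
  toFun x := a * w₁.toFun x + b * w₂.toFun x
  grad x := a • w₁.grad x + b • w₂.grad x
  memLp_toFun := (w₁.memLp_toFun.const_mul a).add (w₂.memLp_toFun.const_mul b)
  memLp_grad := (w₁.memLp_grad.const_smul a).add (w₂.memLp_grad.const_smul b)
  isWeakGrad := w₁.isWeakGrad.linearCombination a b w₁.memLp_toFun w₂.memLp_toFun w₁.memLp_grad
    w₂.memLp_grad w₂.isWeakGrad

/-- The same combination of the smooth approximating sequences converges in all three norms. -/
theorem HasTrace.linearCombination {w₁ w₂ : H1 Ω} {g₁ g₂ : Euc n → ℝ} (a b : ℝ)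
    (h₁ : HasTrace w₁ g₁) (h₂ : HasTrace w₂ g₂) :
    HasTrace (H1.linearCombination a b w₁ w₂) (fun x => a * g₁ x + b * g₂ x) := by
  obtain ⟨m₁, W₁, c₁, t₁, d₁, b₁⟩ := h₁
  obtain ⟨m₂, W₂, c₂, t₂, d₂, b₂⟩ := h₂
  refine ⟨(m₁.const_mul a).add (m₂.const_mul b), fun k x => a * W₁ k x + b * W₂ k x,
    fun k => (contDiff_const.mul (c₁ k)).add (contDiff_const.mul (c₂ k)), ?_, ?_, ?_⟩
  · refine tendsto_eLpNorm_linearCombination a b t₁ t₂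
      (fun k => (c₁ k).continuous.aestronglyMeasurable.sub w₁.memLp_toFun.1)
      (fun k => (c₂ k).continuous.aestronglyMeasurable.sub w₂.memLp_toFun.1) (fun k x => ?_)
    simp only [H1.linearCombination, smul_eq_mul]
    ring
  · refine tendsto_eLpNorm_linearCombination a b d₁ d₂
      (fun k => (continuous_gradient (c₁ k)).aestronglyMeasurable.sub w₁.memLp_grad.1)
      (fun k => (continuous_gradient (c₂ k)).aestronglyMeasurable.sub w₂.memLp_grad.1)
      (fun k x => ?_)
    rw [gradient_linearCombination a b ((c₁ k).differentiable (by simp))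
      ((c₂ k).differentiable (by simp))]
    simp only [H1.linearCombination]
    module
  · refine tendsto_eLpNorm_linearCombination a b b₁ b₂
      (fun k => (c₁ k).continuous.aestronglyMeasurable.sub m₁.1)
      (fun k => (c₂ k).continuous.aestronglyMeasurable.sub m₂.1) (fun k x => ?_)
    simp only [smul_eq_mul]
    ring

theorem HasTrace.memLp_surf {w : H1 Ω} {g : Euc n → ℝ} (h : HasTrace w g)
    (hMΩ : M ⊆ frontier Ω) : MemLp g 2 (surf M) :=
  h.1.mono_measure (Measure.restrict_mono hMΩ le_rfl)

/-! ### Constants as H¹ functions. -/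

theorem integral_gradient_eq_zero {η : Euc n → ℝ} (hη : ContDiff ℝ ∞ η)
    (hc : HasCompactSupport η) : ∫ x, gradient η x = 0 := by
  have hint : Integrable (gradient η) :=
    (continuous_gradient hη).integrable_of_hasCompactSupport (hasCompactSupport_gradient hc)
  refine integral_eq_zero_of_forall_integral_inner_eq_zero ℝ _ hint fun c => ?_
  have hd : Integrable (fun x => fderiv ℝ η x c) := by
    simpa [inner_gradient_right] using hint.const_inner (𝕜 := ℝ) c
  -- Integration by parts against the constant 1, in a fixed direction `c`.
  have h := integral_mul_fderiv_eq_neg_fderiv_mul_of_integrable (μ := volume)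
    (f := fun _ : Euc n => (1 : ℝ)) (g := η) (v := c) (by simp) (by simpa using hd)
    (by simpa using hη.continuous.integrable_of_hasCompactSupport hc)
    (fun x _ => by fun_prop) (fun x _ => (hη.differentiable (by simp)).differentiableAt)
  simpa [inner_gradient_right] using h

theorem isWeakGrad_const (c : ℝ) :
    IsWeakGrad Ω (fun _ => c) (fun _ => 0) := by
  intro η hη hc hs
  have h : ∫ x, gradient η x ∂(vol Ω) = 0 := by
    rw [vol, setIntegral_eq_integral_of_forall_compl_eq_zero, integral_gradient_eq_zero hη hc]
    intro x hx
    have : x ∉ tsupport (fderiv ℝ η) := fun h => hx (hs (tsupport_fderiv_subset ℝ h))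
    simp [gradient, image_eq_zero_of_notMem_tsupport this]
  simp [integral_smul, h]

theorem IsLipschitzDomain.isFiniteMeasure_vol (hΩ : IsLipschitzDomain Ω) :
    IsFiniteMeasure (vol Ω) :=
  ⟨by simpa [vol] using hΩ.isBounded.measure_lt_top⟩

/-- The constant functions as elements of `H¹(Ω)`. -/
def H1.const (hΩ : IsLipschitzDomain Ω) (c : ℝ) : H1 Ω where
  toFun _ := c
  grad _ := 0
  memLp_toFun := by
    have := hΩ.isFiniteMeasure_vol
    exact memLp_const c
  memLp_grad := MemLp.zero'
  isWeakGrad := isWeakGrad_const c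

/-! ### Finite surface measure of a Lipschitz boundary. -/

/-- A bounded part of the graph of a Lipschitz function has finite surface measure. -/
theorem euclideanHausdorffMeasure_graph_lt_top {ν : Euc n} (hν : ‖ν‖ = 1) {K : NNReal}
    {g : Euc n → ℝ} (hg : LipschitzWith K g) {s : Set (Euc n)} (hs : Bornology.IsBounded s)
    (h : ∀ y ∈ s, g (y - inner ℝ ν y • ν) = inner ℝ ν y) :
    (Measure.euclideanHausdorffMeasure (n - 1) : Measure (Euc n)) s < ⊤ := by
  have hν0 : ν ≠ 0 := by rintro rfl; simp at hν
  obtain ⟨m, rfl⟩ : ∃ m, n = m + 1 := by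
    cases n with
    | zero => exact absurd (Subsingleton.elim ν 0) hν0
    | succ m => exact ⟨m, rfl⟩
  have : Fact (Module.finrank ℝ (Euc (m + 1)) = m + 1) := ⟨by simp⟩
  have hdim : Module.finrank ℝ (ℝ ∙ ν)ᗮ = m := Submodule.finrank_orthogonal_span_singleton hν0
  -- Graph parametrization over the hyperplane orthogonal to ν. It is Lipschitz, so it carries a
  -- ball of finite m-dimensional Hausdorff measure to a set of finite measure.
  let F : (ℝ ∙ ν)ᗮ → Euc (m + 1) := fun z => (z : Euc (m + 1)) + g z • ν
  have hF : LipschitzWith (1 + K) F := by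
    refine LipschitzWith.of_dist_le_mul fun z z' => ?_
    have h1 : dist (g z) (g z') ≤ K * dist z z' := hg.dist_le_mul z z'
    have h2 : dist (F z) (F z') ≤ dist z z' + dist (g z) (g z') := by
      refine (dist_add_add_le _ _ _ _).trans ?_
      refine add_le_add le_rfl ?_
      rw [dist_eq_norm, ← sub_smul, norm_smul, hν, mul_one, dist_eq_norm]
    push_cast
    linarith
  obtain ⟨R, hR⟩ := hs.exists_norm_le
  have hsub : s ⊆ F '' Metric.closedBall 0 (R + R) := by
    intro y hy
    have horth : y - inner ℝ ν y • ν ∈ (ℝ ∙ ν)ᗮ := by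
      rw [Submodule.mem_orthogonal_singleton_iff_inner_right, inner_sub_right, inner_smul_right,
        real_inner_self_eq_norm_sq, hν]
      simp
    refine ⟨⟨_, horth⟩, ?_, ?_⟩
    · rw [mem_closedBall_zero_iff]
      refine (norm_sub_le _ _).trans (add_le_add (hR y hy) ?_)
      rw [norm_smul, hν, mul_one]
      refine (norm_inner_le_norm ν y).trans ?_
      rw [hν, one_mul]
      exact hR y hy
    · simp [F, h y hy]
  refine (measure_mono hsub).trans_lt ?_
  rw [Measure.euclideanHausdorffMeasure_def, Measure.smul_apply]
  refine ENNReal.mul_lt_top (by simp) ?_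
  refine (hF.hausdorffMeasure_image_le (by positivity) _).trans_lt ?_
  refine ENNReal.mul_lt_top (ENNReal.rpow_lt_top_of_nonneg (by positivity) (by simp)) ?_
  -- With exponent equal to the dimension of the hyperplane, Hausdorff measure there is finite on
  -- compact sets.
  have : ((m + 1 - 1 : ℕ) : ℝ) = (Module.finrank ℝ (ℝ ∙ ν)ᗮ : ℝ) := by rw [hdim]; simp
  rw [this]
  exact (isCompact_closedBall _ _).measure_lt_top

/-- By compactness it suffices to work near one boundary point, where the boundary lies on a
Lipschitz graph. -/
theorem IsLipschitzDomain.isFiniteMeasure_surf (hΩ : IsLipschitzDomain Ω) :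
    IsFiniteMeasure (surf (frontier Ω)) := by
  have hcpt : IsCompact (frontier Ω) :=
    hΩ.isBounded.isCompact_closure.of_isClosed_subset isClosed_frontier frontier_subset_closure
  refine ⟨?_⟩
  rw [surf, Measure.restrict_apply_univ]
  refine hcpt.measure_lt_top_of_nhdsWithin fun x hx => ?_
  obtain ⟨r, ν, K, g, hr, hν, hg, hy⟩ := hΩ.lipschitz x hx
  refine ⟨frontier Ω ∩ Metric.ball x r,
    inter_mem_nhdsWithin _ (Metric.ball_mem_nhds x hr), ?_⟩
  refine euclideanHausdorffMeasure_graph_lt_top hν hg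
    (Metric.isBounded_ball.subset inter_subset_right) ?_
  rintro y ⟨hyf, hyb⟩
  have hcont : Continuous fun y : Euc n => g (y - inner ℝ ν y • ν) :=
    hg.continuous.comp (by fun_prop)
  have hcont' : Continuous fun y : Euc n => inner ℝ ν y := by fun_prop
  rw [hΩ.isOpen.frontier_eq] at hyf
  -- Strictly above the graph a point lies in Ω; strictly below it, a whole neighbourhood misses Ω.
  -- A boundary point of the open set Ω does neither.
  refine le_antisymm ?_ (not_lt.1 fun hlt => hyf.2 ((hy y hyb).2 hlt))
  by_contra! hlt
  have hnhds : ∀ᶠ z in 𝓝 y, z ∉ Ω := by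
    filter_upwards [(isOpen_lt hcont' hcont).mem_nhds hlt, Metric.isOpen_ball.mem_nhds hyb]
      with z hz hzb hzΩ
    exact lt_asymm hz ((hy z hzb).1 hzΩ)
  exact mem_closure_iff_frequently.1 hyf.1 hnhds

theorem hasTrace_const (hΩ : IsLipschitzDomain Ω) (c : ℝ) :
    HasTrace (H1.const hΩ c) (fun _ => c) := by
  have : IsFiniteMeasure (surf (frontier Ω)) := hΩ.isFiniteMeasure_surf
  refine ⟨memLp_const c, fun _ _ => c, fun _ => contDiff_const, ?_, ?_, ?_⟩ <;>
    simp [H1.const]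

/-! ### Variational inequality and abstract error estimate. -/

/-- The variational inequality satisfied by a minimizer of the energy. -/
theorem integral_inner_grad_sub_nonneg {ψ φ : Euc n → ℝ} {u : H1 Ω} (hu : u ∈ KS Ω M ψ φ)
    (hmin : ∀ w ∈ KS Ω M ψ φ, energy u ≤ energy w) {v : H1 Ω} (hv : v ∈ KS Ω M ψ φ) :
    0 ≤ ∫ x, inner ℝ (u.grad x) (v.grad x - u.grad x) ∂(vol Ω) := by
  obtain ⟨tu, hu, huM, huφ⟩ := hu
  obtain ⟨tv, hv, hvM, hvφ⟩ := hv
  have hw : MemLp (fun x => v.grad x - u.grad x) 2 (vol Ω) := v.memLp_grad.sub u.memLp_grad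
  set P := ∫ x, inner ℝ (u.grad x) (v.grad x - u.grad x) ∂(vol Ω)
  set Q := ∫ x, inner ℝ (v.grad x - u.grad x) (v.grad x - u.grad x) ∂(vol Ω)
  have hQ : 0 ≤ Q := integral_nonneg fun x => real_inner_self_nonneg
  -- Compare u with u + t(v - u): the energy changes by t(P + tQ/2).
  have key : ∀ t : ℝ, 0 < t → t ≤ 1 → 0 ≤ P + t / 2 * Q := by
    intro t ht ht1
    have hmem : H1.linearCombination (1 - t) t u v ∈ KS Ω M ψ φ := by
      refine ⟨_, hu.linearCombination (1 - t) t hv, ?_, ?_⟩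
      · filter_upwards [huM, hvM] with x h1 h2
        nlinarith
      · filter_upwards [huφ, hvφ] with x h1 h2
        rw [h1, h2]
        ring
    have h := hmin _ hmem
    have he : energy (H1.linearCombination (1 - t) t u v)
        = energy u + t * P + t ^ 2 / 2 * Q := by
      have e : ∀ x, ‖(H1.linearCombination (1 - t) t u v).grad x‖ ^ 2 = ‖u.grad x‖ ^ 2
          + 2 * t * inner ℝ (u.grad x) (v.grad x - u.grad x)
          + t ^ 2 * inner ℝ (v.grad x - u.grad x) (v.grad x - u.grad x) := by
        intro x
        have : (H1.linearCombination (1 - t) t u v).grad x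
            = u.grad x + t • (v.grad x - u.grad x) := by
          simp only [H1.linearCombination]
          module
        rw [this, norm_add_sq_real, inner_smul_right, norm_smul, real_inner_self_eq_norm_sq,
          mul_pow, Real.norm_eq_abs, sq_abs]
        ring
      have i₁ : Integrable (fun x => ‖u.grad x‖ ^ 2) (vol Ω) := by
        simpa using integrable_inner_of_memLp u.memLp_grad u.memLp_grad
      have i₂ := (integrable_inner_of_memLp u.memLp_grad hw).const_mul (2 * t)
      have i₃ := (integrable_inner_of_memLp hw hw).const_mul (t ^ 2)
      simp only [energy]
      simp_rw [e]
      rw [integral_add (i₁.fun_add i₂) i₃, integral_add i₁ i₂, integral_const_mul, integral_const_mul]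
      ring
    rw [he] at h
    have : 0 ≤ t * (P + t / 2 * Q) := by nlinarith
    exact nonneg_of_mul_nonneg_right this ht
  by_contra! hP
  -- If P < 0, this t gives tQ/2 ≤ -P/2, so P + tQ/2 < 0. The 1 added to Q keeps the denominator
  -- positive.
  have ht : 0 < min 1 (-P / (Q + 1)) := lt_min one_pos (div_pos (neg_pos.2 hP) (by positivity))
  have h1 := key _ ht (min_le_left _ _)
  have h2 : min 1 (-P / (Q + 1)) * (Q + 1) ≤ -P :=
    (le_div_iff₀ (by positivity)).1 (min_le_right _ _)
  nlinarith

/-- A posteriori error estimate in abstract form: `CF` and `CT` only have to control the two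
functionals of the residuals. -/
theorem lpNorm_grad_sub_le (hMΩ : M ⊆ frontier Ω) {ψ φ : Euc n → ℝ}
    (hψ : MemLp ψ 2 (surf M)) {u v : H1 Ω} {tu tv : Euc n → ℝ}
    (hu : IsAdmissible M ψ φ u tu) (hmin : ∀ w ∈ KS Ω M ψ φ, energy u ≤ energy w)
    (hv : IsAdmissible M ψ φ v tv) {lam : Euc n → ℝ} (hlam : MemMultipliers M lam)
    {q : Euc n → Euc n} {divq qn : Euc n → ℝ} (hq : MemHSDiv Ω M q divq qn) {CF CT : ℝ}
    (hF : |∫ x, divq x * (v.toFun x - u.toFun x) ∂(vol Ω)|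
      ≤ CF * lpNorm (fun x => v.grad x - u.grad x) 2 (vol Ω) * lpNorm divq 2 (vol Ω))
    (hT : |∫ x, (lam x - qn x) * (tv x - tu x) ∂(surf M)|
      ≤ CT * lpNorm (fun x => v.grad x - u.grad x) 2 (vol Ω)
        * lpNorm (fun x => lam x - qn x) 2 (surf M)) (hCF : 0 ≤ CF) (hCT : 0 ≤ CT) :
    lpNorm (fun x => v.grad x - u.grad x) 2 (vol Ω) ≤
      lpNorm (fun x => v.grad x - q x) 2 (vol Ω)
        + √2 * √(∫ x, lam x * (tv x - ψ x) ∂(surf M))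
        + CF * lpNorm divq 2 (vol Ω) + CT * lpNorm (fun x => lam x - qn x) 2 (surf M) := by
  have hvar := integral_inner_grad_sub_nonneg ⟨tu, hu⟩ hmin ⟨tv, hv⟩
  have hw : MemLp (fun x => v.grad x - u.grad x) 2 (vol Ω) := v.memLp_grad.sub u.memLp_grad
  have hvq : MemLp (fun x => v.grad x - q x) 2 (vol Ω) := v.memLp_grad.sub hq.memLp
  have htu : MemLp tu 2 (surf M) := hu.1.memLp_surf hMΩ
  have htv : MemLp tv 2 (surf M) := hv.1.memLp_surf hMΩ
  have htw : MemLp (fun x => tv x - tu x) 2 (surf M) := htv.sub htu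
  have hres : MemLp (fun x => lam x - qn x) 2 (surf M) := hlam.1.sub hq.memLp_normal
  have hgreen : ∫ x, inner ℝ (q x) (v.grad x - u.grad x) ∂(vol Ω)
      + ∫ x, divq x * (v.toFun x - u.toFun x) ∂(vol Ω)
      = ∫ x, qn x * (tv x - tu x) ∂(surf M) := by
    have h := hq.isNormalTrace (H1.linearCombination 1 (-1) v u) _
      ⟨hv.1.linearCombination 1 (-1) hu.1, by
        filter_upwards [hu.2.2, hv.2.2] with x h1 h2
        rw [h1, h2]
        ring⟩
    simpa [H1.linearCombination, ← sub_eq_add_neg] using h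
  have hsq := lpNorm_sq_eq_integral_inner hw
  have hsplit : ∫ x, inner ℝ (v.grad x - u.grad x) (v.grad x - u.grad x) ∂(vol Ω)
      = ∫ x, inner ℝ (v.grad x - q x) (v.grad x - u.grad x) ∂(vol Ω)
        + ∫ x, inner ℝ (q x) (v.grad x - u.grad x) ∂(vol Ω)
        - ∫ x, inner ℝ (u.grad x) (v.grad x - u.grad x) ∂(vol Ω) := by
    rw [← integral_add (integrable_inner_of_memLp hvq hw) (integrable_inner_of_memLp hq.memLp hw),
      ← integral_sub ((integrable_inner_of_memLp hvq hw).fun_add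
        (integrable_inner_of_memLp hq.memLp hw)) (integrable_inner_of_memLp u.memLp_grad hw)]
    congr 1 with x
    simp only [← inner_add_left, ← inner_sub_left, sub_add_cancel]
  have hbd : ∫ x, qn x * (tv x - tu x) ∂(surf M)
      = ∫ x, lam x * (tv x - tu x) ∂(surf M) - ∫ x, (lam x - qn x) * (tv x - tu x) ∂(surf M) := by
    rw [← integral_sub (integrable_mul_of_memLp hlam.1 htw) (integrable_mul_of_memLp hres htw)]
    congr 1 with x
    ring
  have hobst : ∫ x, lam x * (tv x - tu x) ∂(surf M) ≤ ∫ x, lam x * (tv x - ψ x) ∂(surf M) := by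
    refine integral_mono_ae (integrable_mul_of_memLp hlam.1 htw) (integrable_mul_of_memLp hlam.1 (htv.sub hψ)) ?_
    filter_upwards [hlam.2, hu.2.1] with x h1 h2
    exact mul_le_mul_of_nonneg_left (sub_le_sub_left h2 _) h1
  have hB : 0 ≤ ∫ x, lam x * (tv x - ψ x) ∂(surf M) := by
    refine integral_nonneg_of_ae ?_
    filter_upwards [hlam.2, hv.2.1] with x h1 h2
    exact mul_nonneg h1 (sub_nonneg.2 h2)
  have hcs := integral_inner_le_lpNorm_mul_lpNorm hvq hw
  have hX : 0 ≤ lpNorm (fun x => v.grad x - u.grad x) 2 (vol Ω) := lpNorm_nonneg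
  have hN1 : 0 ≤ lpNorm (fun x => v.grad x - q x) 2 (vol Ω) := lpNorm_nonneg
  have hN2 : 0 ≤ CF * lpNorm divq 2 (vol Ω) := mul_nonneg hCF lpNorm_nonneg
  have hN3 : 0 ≤ CT * lpNorm (fun x => lam x - qn x) 2 (surf M) := mul_nonneg hCT lpNorm_nonneg
  have hF' := (abs_le.1 hF).1
  have hT' := (abs_le.1 hT).1
  generalize lpNorm (fun x => v.grad x - u.grad x) 2 (vol Ω) = X at *
  generalize lpNorm (fun x => v.grad x - q x) 2 (vol Ω) = N at *
  generalize lpNorm divq 2 (vol Ω) = D at *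
  generalize lpNorm (fun x => lam x - qn x) 2 (surf M) = R at *
  generalize ∫ x, lam x * (tv x - ψ x) ∂(surf M) = B at *
  have hmain : X ^ 2 ≤ (N + CF * D + CT * R) * X + B := by linarith
  have hsB : √B ^ 2 = B := Real.sq_sqrt hB
  have hsB0 : 0 ≤ √B := Real.sqrt_nonneg B
  have h2 : (1 : ℝ) ≤ √2 := Real.one_le_sqrt.2 one_le_two
  -- If X > A + √B with A ≥ 0, then X² > A X + √B X ≥ A X + B. The factor √2 in the conclusion only
  -- weakens this bound.
  have hle : X ≤ (N + CF * D + CT * R) + √B := by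
    by_contra! hlt
    nlinarith [mul_nonneg (add_nonneg (add_nonneg hN1 hN2) hN3) hsB0]
  nlinarith [mul_le_mul_of_nonneg_right h2 hsB0]

end Signorini

/-! ### The two estimates. -/

theorem mainTheorem6 {n : ℕ} (Ω M : Set (Signorini.Euc n))
    (hΩ : Signorini.IsLipschitzDomain Ω)
    (hM : MeasurableSet M) (hMΩ : M ⊆ frontier Ω)
    (ψ φ : Signorini.Euc n → ℝ) (hψ : MemLp ψ 2 (Signorini.surf M))
    -- the exact solution: a minimizer of the energy over the admissible set
    (u : Signorini.H1 Ω) (hu : u ∈ Signorini.KS Ω M ψ φ)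
    (hmin : ∀ w ∈ Signorini.KS Ω M ψ φ, Signorini.energy u ≤ Signorini.energy w)
    -- an arbitrary admissible function, with its trace
    (v : Signorini.H1 Ω) (tv : Signorini.Euc n → ℝ) (hv : Signorini.IsAdmissible M ψ φ v tv)
    (lam : Signorini.Euc n → ℝ) (hlam : Signorini.MemMultipliers M lam)
    -- an arbitrary vector field, with its divergence and its normal component
    (q : Signorini.Euc n → Signorini.Euc n) (divq qn : Signorini.Euc n → ℝ)
    (hq : Signorini.MemHSDiv Ω M q divq qn) :
    (∀ CF CTr : ℝ, Signorini.IsFriedrichsConst Ω M CF → Signorini.IsTraceConst Ω M CTr →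
      lpNorm (fun x => v.grad x - u.grad x) 2 (Signorini.vol Ω) ≤
        lpNorm (fun x => v.grad x - q x) 2 (Signorini.vol Ω)
          + √2 * √(∫ x, lam x * (tv x - ψ x) ∂(Signorini.surf M))
          + CF * lpNorm divq 2 (Signorini.vol Ω)
          + CTr * lpNorm (fun x => lam x - qn x) 2 (Signorini.surf M)) ∧
    (∫ x, divq x ∂(Signorini.vol Ω) = 0 → ∫ x, (lam x - qn x) ∂(Signorini.surf M) = 0 →
      ∀ CP CPM : ℝ, Signorini.IsPoincareConst Ω CP → Signorini.IsBoundaryPoincareConst Ω M CPM →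
      lpNorm (fun x => v.grad x - u.grad x) 2 (Signorini.vol Ω) ≤
        lpNorm (fun x => v.grad x - q x) 2 (Signorini.vol Ω)
          + √2 * √(∫ x, lam x * (tv x - ψ x) ∂(Signorini.surf M))
          + CP * lpNorm divq 2 (Signorini.vol Ω)
          + CPM * lpNorm (fun x => lam x - qn x) 2 (Signorini.surf M)) := by
  obtain ⟨tu, hu⟩ := hu
  have hadm := hv.1.linearCombination 1 (-1) hu.1
  have h0 : ∀ᵐ x ∂(Signorini.surf (frontier Ω \ M)), 1 * tv x + -1 * tu x = 0 := by
    filter_upwards [hu.2.2, hv.2.2] with x h1 h2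
    rw [h1, h2]
    ring
  have hw : MemLp (fun x => v.toFun x - u.toFun x) 2 (Signorini.vol Ω) :=
    v.memLp_toFun.sub u.memLp_toFun
  have htw : MemLp (fun x => tv x - tu x) 2 (Signorini.surf M) :=
    (hv.1.memLp_surf hMΩ).sub (hu.1.memLp_surf hMΩ)
  have hres : MemLp (fun x => lam x - qn x) 2 (Signorini.surf M) := hlam.1.sub hq.memLp_normal
  constructor
  · intro CF CTr hCF hCTr
    refine Signorini.lpNorm_grad_sub_le hMΩ hψ hu hmin hv hlam hq ?_ ?_ hCF.1 hCTr.1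
    · rw [mul_comm (CF * _)]
      refine (Signorini.abs_integral_mul_le_lpNorm_mul_lpNorm hq.memLp_div hw).trans ?_
      refine mul_le_mul_of_nonneg_left ?_ lpNorm_nonneg
      simpa [Signorini.H1.linearCombination, ← sub_eq_add_neg] using hCF.2 _ _ ⟨hadm, h0⟩
    · rw [mul_comm (CTr * _)]
      refine (Signorini.abs_integral_mul_le_lpNorm_mul_lpNorm hres htw).trans ?_
      refine mul_le_mul_of_nonneg_left ?_ lpNorm_nonneg
      simpa [Signorini.H1.linearCombination, ← sub_eq_add_neg] using hCTr.2 _ _ ⟨hadm, h0⟩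
  · intro hdiv hflux CP CPM hCP hCPM
    have := hΩ.isFiniteMeasure_vol
    have : IsFiniteMeasure (Signorini.surf M) := by
      have : IsFiniteMeasure (Signorini.surf (frontier Ω)) := hΩ.isFiniteMeasure_surf
      exact isFiniteMeasure_of_le (Signorini.surf (frontier Ω)) (Measure.restrict_mono hMΩ le_rfl)
    refine Signorini.lpNorm_grad_sub_le hMΩ hψ hu hmin hv hlam hq ?_ ?_ hCP.1 hCPM.1
    -- The two residuals are treated separately: the mean over Ω is subtracted here, the mean of the
    -- trace over M below. The shifted functions need not vanish off M, which the Poincaré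
    -- inequalities do not ask for.
    · refine Signorini.abs_integral_mul_le_of_integral_eq_zero hq.memLp_div hw hdiv
        (⨍ y, (v.toFun y - u.toFun y) ∂(Signorini.vol Ω)) ?_
      have h := hCP.2 (Signorini.H1.linearCombination 1 (-1)
        (Signorini.H1.linearCombination 1 (-1) v u)
        (Signorini.H1.const hΩ (⨍ y, (v.toFun y - u.toFun y) ∂(Signorini.vol Ω))))
      simp only [Signorini.H1.linearCombination, Signorini.H1.const, one_mul, neg_mul, one_smul,
        neg_smul, smul_zero, add_zero, ← sub_eq_add_neg] at h
      exact h (integral_sub_average _ _)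
    · refine Signorini.abs_integral_mul_le_of_integral_eq_zero hres htw hflux
        (⨍ y, (tv y - tu y) ∂(Signorini.surf M)) ?_
      have h := hCPM.2 _ _ (hadm.linearCombination 1 (-1)
        (Signorini.hasTrace_const hΩ (⨍ y, (tv y - tu y) ∂(Signorini.surf M))))
      simp only [Signorini.H1.linearCombination, Signorini.H1.const, one_mul, neg_mul, one_smul,
        neg_smul, smul_zero, add_zero, ← sub_eq_add_neg] at h
      exact h (integral_sub_average _ _)
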